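/- **Theorem.** Let $M=(M_p)_{p\in\mathbb N}$ be a sequence of positive reals with $1=M_0\le M_1$, $M_j^2\le M_{j-1}M_{j+1}$ for all $j\ge 1$, and $(M_k)^{1/k}\to\infty$ as $k\to\infty$; put $\mu_p:=M_p/M_{p-1}$ for $p\ge1$. Let $r\ge 1$ be an integer and $a>0$. For an interval $S\subseteq\mathbb R$ with $0\in S$, let $\mathcal A_{r,\{M\}}(S)$ (Roumieu type) be the set of all smooth $f:S\to\mathbb C$ (with one-sided derivatives at endpoints belonging to $S$) such that $f^{(rn+j)}(0)=0$ for all $n\in\mathbb N$ and $1\le j\le r-1$, and $$\sup_{n\in\mathbb N,\,x\in S}\frac{|f^{(rn)}(x)|}{h^nM_n}<\infty\quad\text{for some } h>0;$$ let $\mathcal A_{r,(M)}(S)$ (Beurling type) be defined in the same way with "for every $h>0$" instead of "for some $h>0$". Let $[M]$ stand for either $\{M\}$ or $(M)$, and put $$\mathcal D_{r,[M]}:=\{f\in\mathcal A_{r,[M]}(\mathbb R):\operatorname{supp} f\subseteq[-a,a]\},\qquad \mathcal L_{r,[M]}:=\{f\in\mathcal A_{r,[M]}([0,\infty)):\operatorname{supp}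 f\subseteq[0,a]\},$$ $$\mathcal N_{r,[M]}:=\mathcal A_{r,[M]}([0,\infty)),\qquad \mathcal E_{r,[M]}:=\mathcal A_{r,[M]}([0,a]).$$ Then, for each of the two types and for each of the four classes $\mathcal A\in\{\mathcal D_{r,[M]},\mathcal L_{r,[M]},\mathcal N_{r,[M]},\mathcal E_{r,[M]}\}$, with $S$ the common domain of the functions in $\mathcal A$ ($\mathbb R$, $[0,\infty)$, $[0,\infty)$, $[0,a]$, respectively), the following are equivalent: 1. $\mathcal A$ is nonquasianalytic, that is, for some $x_0\in S$ the Borel map $\mathcal B_{x_0}:f\mapsto(f^{(j)}(x_0))_{j\in\mathbb N}$ is not injective on $\mathcal A$; 2. the Borel map $\mathcal B_0:f\mapsto(f^{(j)}(0))_{j\in\mathbb N}$ is not injective on $\mathcal A$; 3. $M$ satisfies $(\mathrm{nq}_r)$, that is, $\displaystyle\sum_{p\ge1}\Big(\frac1{\mu_p}\Big)^{1/r}<\infty$. -/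

import Mathlib

open scoped ContDiff

namespace RamifiedUltra

/-- The set `LC` of weight sequences: positive, normalized (`1 = M 0 ≤ M 1`), log-convex, and with
`(M k) ^ (1 / k) → ∞`. -/
structure IsLC (M : ℕ → ℝ) : Prop where
  pos : ∀ k, 0 < M k
  zero_eq_one : M 0 = 1
  one_le_one : 1 ≤ M 1
  logConvex : ∀ j, 1 ≤ j → M j ^ 2 ≤ M (j - 1) * M (j + 1)
  tendsto_root : Filter.Tendsto (fun k : ℕ => M k ^ (1 / (k : ℝ))) Filter.atTop Filter.atTop

/-- The quotients `μ_p = M_p / M_{p-1}` for `p ≥ 1`, and `μ_0 = 1`. -/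
noncomputable def mu (M : ℕ → ℝ) (p : ℕ) : ℝ := if p = 0 then 1 else M p / M (p - 1)

/-- Condition `(nq_r)`: the series of `(1 / μ_p) ^ (1 / r)` over `p ≥ 1` converges. -/
def NQ (r : ℕ) (M : ℕ → ℝ) : Prop :=
  Summable fun p : ℕ => (1 / mu M (p + 1)) ^ (1 / (r : ℝ))

/-- The two types of classes: `{M}` (Roumieu) and `(M)` (Beurling). -/
inductive WeightType
  | roumieu
  | beurling

/-- The supremum over `n ∈ ℕ` and `x ∈ S` of `|f^{(rn)}(x)| / (h^n M_n)` is finite. -/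
def FiniteNorm (r : ℕ) (M : ℕ → ℝ) (S : Set ℝ) (h : ℝ) (f : ℝ → ℂ) : Prop :=
  ∃ C : ℝ, ∀ n : ℕ, ∀ x ∈ S, ‖iteratedDerivWithin (r * n) f S x‖ / (h ^ n * M n) ≤ C

/-- The growth condition on `S`: for some `h > 0` (Roumieu), respectively for every `h > 0`
(Beurling), the norm above is finite. -/
def Growth (t : WeightType) (r : ℕ) (M : ℕ → ℝ) (S : Set ℝ) (f : ℝ → ℂ) : Prop :=
  match t with
  | .roumieu => ∃ h : ℝ, 0 < h ∧ FiniteNorm r M S h f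
  | .beurling => ∀ h : ℝ, 0 < h → FiniteNorm r M S h f

/-- `f^{(rn+j)}(0) = 0` for all `n ∈ ℕ` and `j ∈ {1, …, r-1}`, for `f` defined on `S`. -/
def RamifiedAtZero (r : ℕ) (S : Set ℝ) (f : ℝ → ℂ) : Prop :=
  ∀ n j : ℕ, 1 ≤ j → j < r → iteratedDerivWithin (r * n + j) f S 0 = 0

/-! A function on an interval `S ⊆ ℝ` is represented by any function `ℝ → ℂ` that extends it;
every condition below depends on its restriction to `S` only, and two such functions are
identified if they agree on `S`. Derivatives at an endpoint of `S` are one-sided. -/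

/-- `D_{r,[M]}([-a,a])`; the domain of its elements is `ℝ`. -/
def classD (t : WeightType) (r : ℕ) (M : ℕ → ℝ) (a : ℝ) : Set (ℝ → ℂ) :=
  {f | ContDiff ℝ ∞ f ∧ tsupport f ⊆ Set.Icc (-a) a ∧
    RamifiedAtZero r Set.univ f ∧ Growth t r M Set.univ f}

/-- `L_{r,[M]}`, with support in `[0,a]`; the domain of its elements is `[0,∞)`. -/
def classL (t : WeightType) (r : ℕ) (M : ℕ → ℝ) (a : ℝ) : Set (ℝ → ℂ) :=
  {f | ContDiffOn ℝ ∞ f (Set.Ici 0) ∧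
    closure (Function.support f ∩ Set.Ici 0) ⊆ Set.Icc 0 a ∧
    RamifiedAtZero r (Set.Ici 0) f ∧ Growth t r M (Set.Ici 0) f}

/-- `N_{r,[M]}`; the domain of its elements is `[0,∞)`. -/
def classN (t : WeightType) (r : ℕ) (M : ℕ → ℝ) : Set (ℝ → ℂ) :=
  {f | ContDiffOn ℝ ∞ f (Set.Ici 0) ∧
    RamifiedAtZero r (Set.Ici 0) f ∧ Growth t r M (Set.Ici 0) f}

/-- `E_{r,[M]}` on the interval `[0,a]`, which is the domain of its elements. -/
def classE (t : WeightType) (r : ℕ) (M : ℕ → ℝ) (a : ℝ) : Set (ℝ → ℂ) :=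
  {f | ContDiffOn ℝ ∞ f (Set.Icc 0 a) ∧
    RamifiedAtZero r (Set.Icc 0 a) f ∧ Growth t r M (Set.Icc 0 a) f}

/-- The Borel map at `x₀`: the sequence of all derivatives at `x₀` of a function on `S`. -/
noncomputable def borelMap (S : Set ℝ) (x₀ : ℝ) (f : ℝ → ℂ) : ℕ → ℂ :=
  fun j => iteratedDerivWithin j f S x₀

/-- The Borel map at `x₀` is injective on the class `A` of functions on `S`. -/
def BorelInjective (S : Set ℝ) (x₀ : ℝ) (A : Set (ℝ → ℂ)) : Prop :=
  ∀ f ∈ A, ∀ g ∈ A, borelMap S x₀ f = borelMap S x₀ g → Set.EqOn f g S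

/-- A class `A` of functions on `S` is quasianalytic if the Borel map at every point of `S` is
injective on `A`. -/
def Quasianalytic (S : Set ℝ) (A : Set (ℝ → ℂ)) : Prop :=
  ∀ x₀ ∈ S, BorelInjective S x₀ A

end RamifiedUltra

/-! If `NQ` fails, Bang's method applies. Only derivatives of order `r * N` are controlled, so each
`q p = e (h μ_{p+1})^(1/r)` is used `r` times: the product of the first `r * N` factors is `e^(rN)
h^N M_N`. For a difference of two class members that is flat at `x`, `eq_zero_of_flat` propagates
bounds with gain `e^(-rN)` outwards, over steps of length `r / q p`. Divergence of `∑ 1 / q p` means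
that finitely many steps starting from index `N` reach any given point, for every `N`, so the
difference vanishes. The intermediate derivatives are recovered by integration along segments.

If `NQ` holds, repeated averaging of a bump over intervals of lengths `d k` with finite sum gives a
smooth compactly supported `f` with `k`-th derivative at most `∏ 2 / d i`. Multiplying the summable
sequence by weights tending to infinity makes the Beurling bounds hold for every `h`. The support of
`f` avoids `0`, so `f` is flat there, the ramification conditions are automatic, and `f` and `0`
have the same Borel image.

The first half needs only a Roumieu bound and the second gives a Beurling one, so both types and all
four classes are covered by `class_iff`. -/

namespace RamifiedUltra

/-! ### Bang's propagation of smallness from a flat point. -/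

section Quasianalytic

variable {S : Set ℝ} {F : ℕ → ℝ → ℂ} {v : ℕ → ℝ}

/-- A derivative bound growing exponentially away from `x` integrates to such a bound. -/
theorem norm_le_mul_exp_of_deriv_le {f f' : ℝ → ℂ} (hS : Convex ℝ S)
    (hf : ∀ x ∈ S, HasDerivWithinAt f (f' x) S x) {x : ℝ} (hx : x ∈ S) {A q : ℝ}
    (h0 : ‖f x‖ ≤ A) (hf' : ∀ y ∈ S, ‖f' y‖ ≤ A * q * Real.exp (q * |y - x|)) {y : ℝ} (hy : y ∈ S) :
    ‖f y‖ ≤ A * Real.exp (q * |y - x|) := by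
  have hmem : ∀ s ∈ Set.Icc (0 : ℝ) 1, x + s * (y - x) ∈ S := fun s hs =>
    hS.add_smul_sub_mem hx hy hs
  have hmaps : Set.MapsTo (fun s : ℝ => x + s * (y - x)) (Set.Icc 0 1) S := hmem
  have hline : ∀ s : ℝ, HasDerivAt (fun s : ℝ => x + s * (y - x)) (y - x) s := fun s => by
    simpa using ((hasDerivAt_id s).mul_const (y - x)).const_add x
  have hd : ∀ s ∈ Set.Icc (0 : ℝ) 1, HasDerivWithinAt (fun s : ℝ => f (x + s * (y - x)))
      ((y - x) • f' (x + s * (y - x))) (Set.Icc 0 1) s := fun s hs =>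
    (hf _ (hmem s hs)).scomp s (hline s).hasDerivWithinAt hmaps
  have hB : ∀ s : ℝ, HasDerivAt (fun s : ℝ => A * Real.exp (q * (s * |y - x|)))
      (A * (Real.exp (q * (s * |y - x|)) * (q * |y - x|))) s := fun s => by
    simpa using ((((hasDerivAt_id s).mul_const |y - x|).const_mul q).exp).const_mul A
  -- On the segment from `x` to `y`, the function is compared with the barrier `A exp (q s |y -
  -- x|)`, whose derivative dominates.
  have key := image_norm_le_of_norm_deriv_right_le_deriv_boundary
    (f := fun s : ℝ => f (x + s * (y - x))) (a := 0) (b := 1)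
    (fun s hs => (hd s hs).continuousWithinAt)
    (fun s hs => (hd s (Set.Ico_subset_Icc_self hs)).mono_of_mem_nhdsWithin
      (Icc_mem_nhdsGE_of_mem hs)) (by simpa using h0) hB ?_ (Set.right_mem_Icc.2 zero_le_one)
  · simpa using key
  · intro s hs
    have h1 := hf' _ (hmem s (Set.Ico_subset_Icc_self hs))
    rw [add_sub_cancel_left, abs_mul, abs_of_nonneg hs.1] at h1
    rw [norm_smul, Real.norm_eq_abs]
    calc |y - x| * ‖f' (x + s * (y - x))‖
        ≤ |y - x| * (A * q * Real.exp (q * (s * |y - x|))) := by gcongr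
      _ = _ := by ring

/-- Integrating down from the top order `m`: the only global bound is on `F m`, and the lower orders
need bounds at the single point `x`. Each integration trades a factor `v j ≤ q` for the same
exponential. -/
theorem norm_le_prod_mul_exp (hS : Convex ℝ S)
    (hF : ∀ j, ∀ x ∈ S, HasDerivWithinAt (F j) (F (j + 1) x) S x) (hv : ∀ j, 0 < v j)
    {m : ℕ} {q T : ℝ} (hq0 : 0 ≤ q) (hq : ∀ j < m, v j ≤ q) (hT : 0 ≤ T) {x : ℝ} (hx : x ∈ S)
    (h0 : ∀ j < m, ‖F j x‖ ≤ T * ∏ i ∈ Finset.range j, v i)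
    (hm : ∀ y ∈ S, ‖F m y‖ ≤ T * ∏ i ∈ Finset.range m, v i) :
    ∀ j ≤ m, ∀ y ∈ S, ‖F j y‖ ≤ (T * ∏ i ∈ Finset.range j, v i) * Real.exp (q * |y - x|) := by
  have hA : ∀ j, 0 ≤ T * ∏ i ∈ Finset.range j, v i := fun j =>
    mul_nonneg hT (Finset.prod_nonneg fun i _ => (hv i).le)
  intro j hj
  induction hj using Nat.decreasingInduction with
  | self =>
    intro y hy
    exact (hm y hy).trans (le_mul_of_one_le_right (hA m) (Real.one_le_exp (by positivity)))
  | of_succ j hj ih =>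
    intro y hy
    refine norm_le_mul_exp_of_deriv_le hS (hF j) hx (h0 j hj) (fun z hz => (ih z hz).trans ?_) hy
    rw [Finset.prod_range_succ, ← mul_assoc]
    have := mul_le_mul_of_nonneg_left (hq j hj) (hA j)
    gcongr

theorem exists_mem_abs_sub_le (hS : Convex ℝ S) {x y A B : ℝ} (hx : x ∈ S) (hy : y ∈ S)
    (hA : 0 ≤ A) (hB : 0 ≤ B) (h : |y - x| ≤ A + B) :
    ∃ z ∈ S, |z - x| ≤ A ∧ |y - z| ≤ B := by
  rcases le_or_gt |y - x| A with h1 | h1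
  · exact ⟨y, hy, h1, by simpa using hB⟩
  · have hL : 0 < |y - x| := hA.trans_lt h1
    have hθ : A / |y - x| ∈ Set.Icc (0 : ℝ) 1 := ⟨by positivity, (div_le_one hL).2 h1.le⟩
    refine ⟨x + (A / |y - x|) * (y - x), hS.add_smul_sub_mem hx hy hθ, ?_, ?_⟩
    · rw [add_sub_cancel_left, abs_mul, abs_of_nonneg hθ.1, div_mul_cancel₀ _ hL.ne']
    · have h2 : y - (x + A / |y - x| * (y - x)) = (1 - A / |y - x|) * (y - x) := by ring
      rw [h2, abs_mul, abs_of_nonneg (sub_nonneg.2 hθ.2), sub_mul, div_mul_cancel₀ _ hL.ne']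
      linarith

/-- Bang's form of the Denjoy-Carleman theorem, with bounds on every `r`-th derivative only. -/
theorem eq_zero_of_flat (hS : Convex ℝ S)
    (hF : ∀ j, ∀ x ∈ S, HasDerivWithinAt (F j) (F (j + 1) x) S x) {r : ℕ} (hr : 1 ≤ r)
    {q : ℕ → ℝ} (hq : ∀ p, 0 < q p) (hmono : Monotone q)
    (hdiv : ¬ Summable fun p => 1 / q p) {C : ℝ}
    (hb : ∀ N, ∀ y ∈ S,
      ‖F (r * N) y‖ ≤ C * Real.exp (-(r * N : ℕ)) * ∏ i ∈ Finset.range (r * N), q (i / r))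
    {x : ℝ} (hx : x ∈ S) (h0 : ∀ j, F j x = 0) {y : ℝ} (hy : y ∈ S) : F 0 y = 0 := by
  have hC : 0 ≤ C := by simpa using (norm_nonneg _).trans (hb 0 x hx)
  have hrpos : 0 < r := hr
  -- Descending from `N = K`, where the sum is empty and flatness at `x` suffices, each step
  -- enlarges the admissible distance by `r / q N` and gives up one factor `e^(-r)`.
  have claim : ∀ K N, N ≤ K → ∀ y ∈ S, |y - x| ≤ ∑ p ∈ Finset.Ico N K, (r : ℝ) / q p →
      ∀ j ≤ r * N,
        ‖F j y‖ ≤ C * Real.exp (-(r * N : ℕ)) * ∏ i ∈ Finset.range j, q (i / r) := by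
    intro K N hN
    induction hN using Nat.decreasingInduction with
    | self =>
      intro y hy hd j _
      have : y = x := by simpa [sub_eq_zero] using hd
      rw [this, h0, norm_zero]
      exact mul_nonneg (by positivity) (Finset.prod_nonneg fun i _ => (hq _).le)
    | of_succ N hN ih =>
      intro y hy hd j hj
      rw [Finset.sum_eq_sum_Ico_succ_bot hN, add_comm] at hd
      obtain ⟨z, hz, hzx, hyz⟩ := exists_mem_abs_sub_le hS hx hy
        (Finset.sum_nonneg fun i _ => div_nonneg (Nat.cast_nonneg r) (hq i).le)
        (div_nonneg (Nat.cast_nonneg r) (hq N).le) hd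
      have h1 := norm_le_prod_mul_exp hS hF (v := fun i => q (i / r)) (m := r * (N + 1))
        (fun i => hq _) (hq N).le
        (fun i hi => hmono (Nat.lt_succ_iff.1 (Nat.div_lt_of_lt_mul hi)))
        (T := C * Real.exp (-(r * (N + 1) : ℕ))) (by positivity) hz
        (fun i hi => ih z hz hzx i hi.le) (hb (N + 1)) j
        (hj.trans (Nat.mul_le_mul_left r N.le_succ)) y hy
      refine h1.trans ?_
      -- The exponential growth over the last step is thus at most `e^r`, exactly the ratio of
      -- `e^(-rN)` to `e^(-r(N+1))`.
      have h2 : q N * |y - z| ≤ r := by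
        rwa [le_div_iff₀ (hq N), mul_comm] at hyz
      have hP : 0 ≤ ∏ i ∈ Finset.range j, q (i / r) := Finset.prod_nonneg fun i _ => (hq _).le
      calc _ ≤ C * Real.exp (-(r * (N + 1) : ℕ)) * (∏ i ∈ Finset.range j, q (i / r))
              * Real.exp r := by gcongr
        _ = C * (Real.exp (-(r * (N + 1) : ℕ)) * Real.exp r)
              * ∏ i ∈ Finset.range j, q (i / r) := by ring
        _ = _ := by
          rw [← Real.exp_add]
          push_cast
          ring_nf
  have hdiv' : ¬ Summable fun p => (r : ℝ) / q p := by
    intro h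
    refine hdiv ((h.mul_left (1 / (r : ℝ))).congr fun p => ?_)
    have : (r : ℝ) ≠ 0 := by positivity
    field_simp
  have htend := (not_summable_iff_tendsto_nat_atTop_of_nonneg
    (fun p => div_nonneg (Nat.cast_nonneg r) (hq p).le)).1 hdiv'
  have hle : ∀ N : ℕ, ‖F 0 y‖ ≤ C * Real.exp (-(N : ℝ)) := by
    intro N
    obtain ⟨K, hK1, hK2⟩ := ((htend.eventually_ge_atTop
      (|y - x| + ∑ p ∈ Finset.range N, (r : ℝ) / q p)).and (Filter.eventually_ge_atTop N)).exists
    have h1 := claim K N hK2 y hy (by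
      rw [Finset.sum_Ico_eq_sub _ hK2]; linarith) 0 (Nat.zero_le _)
    rw [Finset.range_zero, Finset.prod_empty, mul_one] at h1
    refine h1.trans (mul_le_mul_of_nonneg_left (Real.exp_le_exp.2 (neg_le_neg ?_)) hC)
    exact_mod_cast Nat.le_mul_of_pos_left N hrpos
  have hlim : Filter.Tendsto (fun N : ℕ => C * Real.exp (-(N : ℝ))) Filter.atTop (nhds 0) := by
    simpa using (Real.tendsto_exp_neg_atTop_nhds_zero.comp
      tendsto_natCast_atTop_atTop).const_mul C
  exact norm_le_zero_iff.1 (ge_of_tendsto' hlim hle)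

end Quasianalytic

/-! ### Quotients of the weight sequence, and quasianalyticity when `NQ` fails. -/

section Weight

variable {M : ℕ → ℝ}

theorem mu_succ (M : ℕ → ℝ) (p : ℕ) : mu M (p + 1) = M (p + 1) / M p := by simp [mu]

theorem IsLC.mu_pos (hM : IsLC M) (p : ℕ) : 0 < mu M (p + 1) := by
  rw [mu_succ]
  exact div_pos (hM.pos _) (hM.pos _)

theorem IsLC.monotone_mu (hM : IsLC M) : Monotone fun p => mu M (p + 1) := by
  refine monotone_nat_of_le_succ fun p => ?_
  have h := hM.logConvex (p + 1) (by omega)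
  simp only [Nat.add_sub_cancel] at h
  rw [mu_succ, mu_succ, div_le_div_iff₀ (hM.pos _) (hM.pos _)]
  linarith

theorem IsLC.prod_mu (hM : IsLC M) (n : ℕ) : ∏ p ∈ Finset.range n, mu M (p + 1) = M n := by
  induction n with
  | zero => simp [hM.zero_eq_one]
  | succ n ih =>
    rw [Finset.prod_range_succ, ih, mu_succ, mul_div_cancel₀ _ (hM.pos n).ne']

theorem prod_range_mul_div {r : ℕ} (hr : 1 ≤ r) (q : ℕ → ℝ) (N : ℕ) :
    ∏ i ∈ Finset.range (r * N), q (i / r) = ∏ p ∈ Finset.range N, q p ^ r := by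
  induction N with
  | zero => simp
  | succ N ih =>
    rw [Nat.mul_succ, Finset.prod_range_add, ih, Finset.prod_range_succ]
    congr 1
    rw [Finset.prod_congr rfl (g := fun _ => q N), Finset.prod_const, Finset.card_range]
    intro i hi
    rw [Nat.mul_add_div (by omega), Nat.div_eq_of_lt (Finset.mem_range.1 hi), add_zero]

end Weight

theorem hasDerivWithinAt_iteratedDerivWithin {S : Set ℝ} (hu : UniqueDiffOn ℝ S) {f : ℝ → ℂ}
    (hf : ContDiffOn ℝ ∞ f S) (j : ℕ) {x : ℝ} (hx : x ∈ S) :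
    HasDerivWithinAt (iteratedDerivWithin j f S) (iteratedDerivWithin (j + 1) f S x) S x := by
  rw [iteratedDerivWithin_succ]
  exact (hf.differentiableOn_iteratedDerivWithin (by exact_mod_cast ENat.natCast_lt_top j) hu
    x hx).hasDerivWithinAt

theorem Growth.roumieu {t : WeightType} {r : ℕ} {M : ℕ → ℝ} {S : Set ℝ} {f : ℝ → ℂ}
    (h : Growth t r M S f) : ∃ h : ℝ, 0 < h ∧ FiniteNorm r M S h f := by
  cases t with
  | roumieu => exact h
  | beurling => exact ⟨1, one_pos, h 1 one_pos⟩

theorem FiniteNorm.exists_le {r : ℕ} {M : ℕ → ℝ} (hM : IsLC M) {S : Set ℝ} {f : ℝ → ℂ} {h : ℝ}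
    (hh : 0 < h) (hf : FiniteNorm r M S h f) : ∃ C : ℝ, 0 ≤ C ∧ ∀ k, h ≤ k → ∀ n, ∀ x ∈ S,
      ‖iteratedDerivWithin (r * n) f S x‖ ≤ C * (k ^ n * M n) := by
  obtain ⟨C, hC⟩ := hf
  refine ⟨max C 0, le_max_right _ _, fun k hk n x hx => ?_⟩
  have h1 := hC n x hx
  have hMn := hM.pos n
  rw [div_le_iff₀ (by positivity)] at h1
  refine h1.trans (mul_le_mul (le_max_left _ _) ?_ (by positivity) (le_max_right _ _))
  gcongr

theorem quasianalytic_of_not_NQ {M : ℕ → ℝ} (hM : IsLC M) {r : ℕ} (hr : 1 ≤ r)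
    (hnq : ¬ NQ r M) {t : WeightType} {S : Set ℝ} (hS : Convex ℝ S) (hu : UniqueDiffOn ℝ S)
    {A : Set (ℝ → ℂ)} (hA : ∀ f ∈ A, ContDiffOn ℝ ∞ f S ∧ Growth t r M S f) :
    Quasianalytic S A := by
  intro x hx f hf g hg hfg y hy
  obtain ⟨h₁, hh₁, hf₁⟩ := (hA f hf).2.roumieu
  obtain ⟨h₂, hh₂, hg₂⟩ := (hA g hg).2.roumieu
  obtain ⟨C₁, hC₁, hf₁⟩ := hf₁.exists_le hM hh₁
  obtain ⟨C₂, hC₂, hg₂⟩ := hg₂.exists_le hM hh₂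
  set h := max h₁ h₂ with hdef
  have hh : 0 < h := hh₁.trans_le (le_max_left _ _)
  have hr0 : (r : ℝ) ≠ 0 := by positivity
  -- The factor `e` creates the decay `e^(-rN)` required by `eq_zero_of_flat`; it does not affect
  -- divergence of `∑ 1 / q p`.
  let q : ℕ → ℝ := fun p => Real.exp 1 * (h * mu M (p + 1)) ^ (1 / (r : ℝ))
  have hq : ∀ p, 0 < q p := fun p =>
    mul_pos (Real.exp_pos 1) (Real.rpow_pos_of_pos (mul_pos hh (hM.mu_pos p)) _)
  have hmono : Monotone q := fun p p' hp => by
    have := hM.mu_pos p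
    have := hM.monotone_mu hp
    simp only at this
    simp only [q]
    gcongr
  have hqr : ∀ N, Real.exp (-(r * N : ℕ)) * ∏ i ∈ Finset.range (r * N), q (i / r)
      = h ^ N * M N := fun N => by
    have hqp : ∀ p, q p ^ r = Real.exp r * (h * mu M (p + 1)) := fun p => by
      rw [mul_pow, ← Real.exp_nat_mul, mul_one, one_div,
        Real.rpow_inv_natCast_pow (mul_pos hh (hM.mu_pos p)).le (by omega)]
    simp_rw [prod_range_mul_div hr, hqp]
    rw [Finset.prod_mul_distrib, Finset.prod_mul_distrib, hM.prod_mu, Finset.prod_const,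
      Finset.prod_const, Finset.card_range, ← mul_assoc, ← Real.exp_nat_mul, ← Real.exp_add]
    push_cast
    rw [show -((r : ℝ) * N) + N * r = 0 by ring, Real.exp_zero, one_mul]
  have hdiv : ¬ Summable fun p => 1 / q p := by
    intro hs
    refine hnq ((hs.mul_left (Real.exp 1 * h ^ (1 / (r : ℝ)))).congr fun p => ?_)
    have hmu := hM.mu_pos p
    simp only [q]
    rw [Real.mul_rpow hh.le hmu.le, Real.div_rpow zero_le_one hmu.le, Real.one_rpow]
    have := Real.rpow_pos_of_pos hh (1 / (r : ℝ))
    have := Real.rpow_pos_of_pos hmu (1 / (r : ℝ))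
    have := Real.exp_pos 1
    field_simp
  have key := eq_zero_of_flat hS
    (F := fun j => iteratedDerivWithin j f S - iteratedDerivWithin j g S)
    (fun j z hz => (hasDerivWithinAt_iteratedDerivWithin hu (hA f hf).1 j hz).sub
      (hasDerivWithinAt_iteratedDerivWithin hu (hA g hg).1 j hz))
    hr hq hmono hdiv (C := C₁ + C₂) (fun N z hz => ?_) hx
    (fun j => sub_eq_zero.2 (congrFun hfg j)) hy
  · simpa [sub_eq_zero] using key
  · rw [mul_assoc, hqr, add_mul]
    exact (norm_sub_le _ _).trans (add_le_add (hf₁ h (le_max_left _ _) N z hz)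
      (hg₂ h (le_max_right _ _) N z hz))

/-! ### Smooth bumps from infinitely many averages. -/

section Averages

/-- The average of `u` over `[x - d, x]`. -/
noncomputable def avg (d : ℝ) (u : ℝ → ℂ) (x : ℝ) : ℂ := d⁻¹ • ∫ t in (x - d)..x, u t

variable {d : ℝ} {u : ℝ → ℂ}

theorem hasDerivAt_avg (hu : Continuous u) (x : ℝ) :
    HasDerivAt (avg d u) (d⁻¹ • (u x - u (x - d))) x := by
  have hi : ∀ a b, IntervalIntegrable u MeasureTheory.volume a b := fun a b =>
    hu.intervalIntegrable a b
  have h1 : ∀ y : ℝ, HasDerivAt (fun z => ∫ t in (0 : ℝ)..z, u t) (u y) y := fun y =>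
    intervalIntegral.integral_hasDerivAt_right (hi _ _)
      hu.aestronglyMeasurable.stronglyMeasurableAtFilter hu.continuousAt
  have h2 := (((h1 x).sub ((h1 (x - d)).comp_sub_const x d)).const_smul d⁻¹)
  refine h2.congr_of_eventuallyEq (Filter.Eventually.of_forall fun y => ?_)
  simp only [avg, Pi.smul_apply, Pi.sub_apply]
  rw [intervalIntegral.integral_interval_sub_left (hi _ _) (hi _ _)]

theorem deriv_avg (hu : ContDiff ℝ ∞ u) : deriv (avg d u) = avg d (deriv u) := by
  ext x
  rw [(hasDerivAt_avg hu.continuous x).deriv, avg, intervalIntegral.integral_deriv_eq_sub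
    (fun y _ => hu.contDiffAt.differentiableAt (by simp))
    ((contDiff_infty_iff_deriv.1 hu).2.continuous.intervalIntegrable _ _)]

theorem contDiff_avg (hu : ContDiff ℝ ∞ u) : ContDiff ℝ ∞ (avg d u) := by
  rw [contDiff_infty_iff_deriv]
  refine ⟨fun x => (hasDerivAt_avg hu.continuous x).differentiableAt, ?_⟩
  have : deriv (avg d u) = fun x => d⁻¹ • (u x - u (x - d)) :=
    funext fun x => (hasDerivAt_avg hu.continuous x).deriv
  rw [this]
  fun_prop

theorem iteratedDeriv_avg (k : ℕ) (hu : ContDiff ℝ ∞ u) :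
    iteratedDeriv k (avg d u) = avg d (iteratedDeriv k u) := by
  induction k generalizing u with
  | zero => simp
  | succ k ih =>
    rw [iteratedDeriv_succ', iteratedDeriv_succ', deriv_avg hu,
      ih (contDiff_infty_iff_deriv.1 hu).2]

theorem norm_avg_le (hd : 0 < d) {C : ℝ} (hC : ∀ x, ‖u x‖ ≤ C) (x : ℝ) : ‖avg d u x‖ ≤ C := by
  have h := intervalIntegral.norm_integral_le_of_norm_le_const (a := x - d) (b := x)
    fun t _ => hC t
  rw [sub_sub_cancel, abs_of_pos hd] at h
  rw [avg, norm_smul, norm_inv, Real.norm_eq_abs, abs_of_pos hd, inv_mul_le_iff₀ hd, mul_comm]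
  exact h

theorem avg_congr (hd : 0 < d) {x : ℝ} {c : ℂ} (h : ∀ t ∈ Set.Icc (x - d) x, u t = c) :
    avg d u x = c := by
  have : ∫ t in (x - d)..x, u t = ∫ t in (x - d)..x, c :=
    intervalIntegral.integral_congr fun t ht => h t (by
      rwa [Set.uIcc_of_le (by linarith)] at ht)
  rw [avg, this, intervalIntegral.integral_const, sub_sub_cancel, inv_smul_smul₀ hd.ne']

theorem norm_avg_sub_le (hd : 0 < d) (hu : ContDiff ℝ ∞ u) {C : ℝ} (hC : ∀ x, ‖deriv u x‖ ≤ C)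
    (x : ℝ) : ‖avg d u x - u x‖ ≤ d * C := by
  have hC0 : 0 ≤ C := (norm_nonneg _).trans (hC x)
  have h1 : avg d u x - u x = d⁻¹ • ∫ t in (x - d)..x, (u t - u x) := by
    rw [intervalIntegral.integral_sub (hu.continuous.intervalIntegrable _ _)
      (by simp), smul_sub, intervalIntegral.integral_const, sub_sub_cancel,
      inv_smul_smul₀ hd.ne', avg]
  have h2 := intervalIntegral.norm_integral_le_of_norm_le_const (a := x - d) (b := x)
    (f := fun t => u t - u x) (C := d * C) fun t ht => by
      rw [Set.uIoc_of_le (by linarith)] at ht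
      have h3 := convex_univ.norm_image_sub_le_of_norm_deriv_le (𝕜 := ℝ) (f := u)
        (fun y _ => hu.contDiffAt.differentiableAt (by simp)) (fun y _ => hC y)
        (Set.mem_univ x) (Set.mem_univ t)
      refine h3.trans ?_
      rw [mul_comm, Real.norm_eq_abs]
      gcongr
      rw [abs_le]
      constructor <;> linarith [ht.1, ht.2]
  rw [sub_sub_cancel, abs_of_pos hd] at h2
  rw [h1, norm_smul, norm_inv, Real.norm_eq_abs, abs_of_pos hd, inv_mul_le_iff₀ hd, mul_comm]
  exact h2

/-- The derivative of an average is a difference quotient, so one extra derivative costs `2 / d`. -/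
theorem norm_iteratedDeriv_succ_avg_le (hd : 0 < d) (hu : ContDiff ℝ ∞ u) {k : ℕ} {C : ℝ}
    (hC : ∀ x, ‖iteratedDeriv k u x‖ ≤ C) (x : ℝ) :
    ‖iteratedDeriv (k + 1) (avg d u) x‖ ≤ C * (2 / d) := by
  have hc : Continuous (iteratedDeriv k u) :=
    hu.continuous_iteratedDeriv k (by exact_mod_cast le_top)
  rw [iteratedDeriv_succ, iteratedDeriv_avg k hu, (hasDerivAt_avg hc x).deriv, norm_smul, norm_inv,
    Real.norm_eq_abs, abs_of_pos hd]
  calc d⁻¹ * ‖iteratedDeriv k u x - iteratedDeriv k u (x - d)‖ ≤ d⁻¹ * (C + C) := by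
        gcongr
        exact (norm_sub_le _ _).trans (add_le_add (hC _) (hC _))
    _ = C * (2 / d) := by ring

/-- Successive averages of `u` with the steps `d 0, d 1, …`. -/
noncomputable def iterAvg (d : ℕ → ℝ) (u : ℝ → ℂ) : ℕ → ℝ → ℂ
  | 0 => u
  | n + 1 => avg (d n) (iterAvg d u n)

variable {d : ℕ → ℝ}

theorem contDiff_iterAvg (hu : ContDiff ℝ ∞ u) (n : ℕ) : ContDiff ℝ ∞ (iterAvg d u n) := by
  induction n with
  | zero => exact hu
  | succ n ih => exact contDiff_avg ih

theorem norm_iteratedDeriv_iterAvg_le (hd : ∀ n, 0 < d n) (hu : ContDiff ℝ ∞ u) {k : ℕ} {C : ℝ}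
    (hC : ∀ x, ‖iteratedDeriv k u x‖ ≤ C) (n : ℕ) (x : ℝ) :
    ‖iteratedDeriv k (iterAvg d u n) x‖ ≤ C := by
  induction n generalizing x with
  | zero => exact hC x
  | succ n ih =>
    rw [iterAvg, iteratedDeriv_avg k (contDiff_iterAvg hu n)]
    exact norm_avg_le (hd n) ih x

/-- Each of the first `k` averages absorbs one derivative; the remaining ones do not increase the
supremum. -/
theorem norm_iteratedDeriv_iterAvg_le_prod (hd : ∀ n, 0 < d n) (hu : ContDiff ℝ ∞ u)
    (h1 : ∀ x, ‖u x‖ ≤ 1) {n k : ℕ} (hk : k ≤ n) (x : ℝ) :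
    ‖iteratedDeriv k (iterAvg d u n) x‖ ≤ ∏ i ∈ Finset.range k, (2 / d i) := by
  induction n generalizing k x with
  | zero =>
    obtain rfl : k = 0 := by omega
    simpa [iterAvg] using h1 x
  | succ n ih =>
    rcases hk.lt_or_eq with hk | rfl
    · rw [iterAvg, iteratedDeriv_avg k (contDiff_iterAvg hu n)]
      exact norm_avg_le (hd n) (fun y => ih (by omega) y) x
    · rw [Finset.prod_range_succ]
      exact norm_iteratedDeriv_succ_avg_le (hd n) (contDiff_iterAvg hu n) (fun y => ih le_rfl y) x

theorem norm_iteratedDeriv_iterAvg_sub_le (hd : ∀ n, 0 < d n) (hu : ContDiff ℝ ∞ u) {k : ℕ} {C : ℝ}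
    (hC : ∀ x, ‖iteratedDeriv (k + 1) u x‖ ≤ C) (n : ℕ) (x : ℝ) :
    ‖iteratedDeriv k (iterAvg d u (n + 1) - iterAvg d u n) x‖ ≤ d n * C := by
  have hn := contDiff_iterAvg (d := d) hu n
  have hk : (k : ℕ∞ω) ≤ ∞ := by exact_mod_cast le_top
  rw [iteratedDeriv_sub ((contDiff_iterAvg hu (n + 1)).of_le hk).contDiffAt
    (hn.of_le hk).contDiffAt, iterAvg, iteratedDeriv_avg k hn]
  refine norm_avg_sub_le (hd n) ?_ (fun y => ?_) x
  · rw [iteratedDeriv_eq_iterate]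
    exact hn.iterate_deriv k
  · rw [← iteratedDeriv_succ]
    exact norm_iteratedDeriv_iterAvg_le hd hu hC n y

theorem iterAvg_eq_zero (hd : ∀ n, 0 < d n) {l m : ℝ} (hl : ∀ x < l, u x = 0)
    (hm : ∀ x, m < x → u x = 0) (n : ℕ) :
    (∀ x < l, iterAvg d u n x = 0) ∧
      ∀ x, m + ∑ i ∈ Finset.range n, d i < x → iterAvg d u n x = 0 := by
  induction n with
  | zero => simpa [iterAvg] using ⟨hl, hm⟩
  | succ n ih =>
    refine ⟨fun x hx => avg_congr (hd n) fun t ht => ih.1 t (ht.2.trans_lt hx),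
      fun x hx => avg_congr (hd n) fun t ht => ih.2 t ?_⟩
    rw [Finset.sum_range_succ] at hx
    linarith [ht.1]

theorem iterAvg_eq_one (hd : ∀ n, 0 < d n) {l m : ℝ} (h : ∀ x ∈ Set.Icc l m, u x = 1) (n : ℕ) :
    ∀ x ∈ Set.Icc (l + ∑ i ∈ Finset.range n, d i) m, iterAvg d u n x = 1 := by
  induction n with
  | zero => simpa [iterAvg] using h
  | succ n ih =>
    intro x hx
    rw [Finset.sum_range_succ] at hx
    exact avg_congr (hd n) fun t ht => ih t ⟨by linarith [hx.1, ht.1], ht.2.trans hx.2⟩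

/-- The limit of the successive averages of a smooth compactly supported function. -/
theorem exists_limit_iterAvg (hd : ∀ n, 0 < d n) (hs : Summable d) (hu : ContDiff ℝ ∞ u)
    (hc : HasCompactSupport u) (h1 : ∀ x, ‖u x‖ ≤ 1) :
    ∃ f : ℝ → ℂ, ContDiff ℝ ∞ f ∧
      (∀ x, Filter.Tendsto (fun n => iterAvg d u n x) Filter.atTop (nhds (f x))) ∧
      ∀ k x, ‖iteratedDeriv k f x‖ ≤ ∏ i ∈ Finset.range k, (2 / d i) := by
  have hB : ∀ k, ∃ C, ∀ x, ‖iteratedDeriv k u x‖ ≤ C := fun k => by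
    obtain ⟨C, hC⟩ := (hc.iteratedFDeriv (𝕜 := ℝ) k).exists_bound_of_continuous
      (hu.continuous_iteratedFDeriv (by exact_mod_cast le_top))
    exact ⟨C, fun x => by simpa [norm_iteratedFDeriv_eq_norm_iteratedDeriv] using hC x⟩
  choose B hB using hB
  -- The limit is `u` plus this telescoping series. An average moves a function by at most `d n`
  -- times the bound on its derivative, so the series converges with all derivatives.
  set g : ℕ → ℝ → ℂ := fun n => iterAvg d u (n + 1) - iterAvg d u n with hg
  have hgs : ∀ n, ContDiff ℝ ∞ (g n) := fun n =>
    (contDiff_iterAvg hu (n + 1)).sub (contDiff_iterAvg hu n)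
  have hv : ∀ k : ℕ, (k : ℕ∞) ≤ ⊤ → Summable fun n => d n * B (k + 1) := fun k _ =>
    hs.mul_right _
  have hb : ∀ (k : ℕ) (n : ℕ) (x : ℝ), (k : ℕ∞) ≤ ⊤ →
      ‖iteratedFDeriv ℝ k (g n) x‖ ≤ d n * B (k + 1) := fun k n x _ => by
    rw [norm_iteratedFDeriv_eq_norm_iteratedDeriv]
    exact norm_iteratedDeriv_iterAvg_sub_le hd hu (hB (k + 1)) n x
  have hG : ContDiff ℝ ∞ fun x => ∑' n, g n x := contDiff_tsum hgs hv hb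
  have hlim : ∀ k x, Filter.Tendsto (fun n => iteratedFDeriv ℝ k (iterAvg d u n) x) Filter.atTop
      (nhds (iteratedFDeriv ℝ k (u + fun x => ∑' n, g n x) x)) := fun k x => by
    have hk : (k : ℕ∞ω) ≤ ∞ := by exact_mod_cast le_top
    have hsum : Summable fun n => iteratedFDeriv ℝ k (g n) x :=
      .of_norm_bounded (hv k le_top) fun n => hb k n x le_top
    rw [iteratedFDeriv_add_apply (hu.of_le hk).contDiffAt (hG.of_le hk).contDiffAt,
      iteratedFDeriv_tsum_apply hgs hv hb le_top]
    refine (hsum.hasSum.tendsto_sum_nat.const_add _).congr fun n => ?_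
    have : ∀ i, iteratedFDeriv ℝ k (g i) x = iteratedFDeriv ℝ k (iterAvg d u (i + 1)) x
        - iteratedFDeriv ℝ k (iterAvg d u i) x := fun i =>
      iteratedFDeriv_sub_apply ((contDiff_iterAvg hu (i + 1)).of_le hk).contDiffAt
        ((contDiff_iterAvg hu i).of_le hk).contDiffAt
    simp_rw [this]
    rw [Finset.sum_range_sub (fun i => iteratedFDeriv ℝ k (iterAvg d u i) x)]
    simp [iterAvg]
  refine ⟨u + fun x => ∑' n, g n x, hu.add hG, fun x => ?_, fun k x => ?_⟩
  · have hsum : Summable fun n => g n x := .of_norm_bounded (hv 0 le_top) fun n => by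
      simpa using hb 0 n x le_top
    refine (hsum.hasSum.tendsto_sum_nat.const_add (u x)).congr fun n => ?_
    simp only [hg, Pi.sub_apply]
    rw [Finset.sum_range_sub (fun i => iterAvg d u i x)]
    simp [iterAvg]
  · rw [← norm_iteratedFDeriv_eq_norm_iteratedDeriv]
    refine le_of_tendsto (hlim k x).norm ?_
    filter_upwards [Filter.eventually_ge_atTop k] with n hn
    rw [norm_iteratedFDeriv_eq_norm_iteratedDeriv]
    exact norm_iteratedDeriv_iterAvg_le_prod hd hu h1 hn x

theorem exists_smooth_bump_of_summable (hd : ∀ n, 0 < d n) (hs : Summable d) {l ε : ℝ} (hε : 0 < ε)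
    (hle : ∑' n, d n ≤ ε) :
    ∃ f : ℝ → ℂ, ContDiff ℝ ∞ f ∧ Function.support f ⊆ Set.Icc l (l + 5 * ε) ∧
      f (l + 3 * ε) = 1 ∧ ∀ k x, ‖iteratedDeriv k f x‖ ≤ ∏ i ∈ Finset.range k, (2 / d i) := by
  have hpart : ∀ n, ∑ i ∈ Finset.range n, d i ≤ ε := fun n =>
    (hs.sum_le_tsum _ fun i _ => (hd i).le).trans hle
  -- `φ` vanishes off `[l, l + 4ε]` and is `1` on `[l + ε, l + 3ε]`. Averages look only to the left,
  -- by at most `ε` in total: the support may extend right to `l + 5ε`, and the value at `l + 3ε`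
  -- stays `1`.
  let φ : ContDiffBump (l + 2 * ε) := ⟨ε, 2 * ε, hε, by linarith⟩
  have hφ0 : ∀ x, 2 * ε ≤ |x - (l + 2 * ε)| → ((φ x : ℝ) : ℂ) = 0 := fun x hx => by
    rw [φ.zero_of_le_dist (by rwa [Real.dist_eq]), Complex.ofReal_zero]
  obtain ⟨f, hf, hlim, hb⟩ := exists_limit_iterAvg (u := fun x => ((φ x : ℝ) : ℂ)) hd hs
    (Complex.ofRealCLM.contDiff.comp φ.contDiff)
    (φ.hasCompactSupport.comp_left Complex.ofReal_zero)
    (fun x => by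
      rw [Complex.norm_real, Real.norm_eq_abs, abs_of_nonneg φ.nonneg]
      exact φ.le_one)
  have hz := iterAvg_eq_zero (u := fun x => ((φ x : ℝ) : ℂ)) hd (l := l) (m := l + 4 * ε)
    (fun x hx => hφ0 x (by rw [le_abs]; right; linarith))
    (fun x hx => hφ0 x (by rw [le_abs]; left; linarith))
  refine ⟨f, hf, fun x hx => ?_, ?_, hb⟩
  · by_contra hmem
    refine hx (tendsto_nhds_unique (hlim x) (tendsto_const_nhds.congr fun n => ?_))
    rw [Set.mem_Icc, not_and_or, not_le, not_le] at hmem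
    rcases hmem with hmem | hmem
    · exact ((hz n).1 x hmem).symm
    · exact ((hz n).2 x (by linarith [hpart n])).symm
  · refine tendsto_nhds_unique (hlim _) (tendsto_const_nhds.congr fun n => ?_)
    refine (iterAvg_eq_one hd (l := l + ε) (m := l + 3 * ε) (fun x hx => ?_) n _
      ⟨by linarith [hpart n], le_rfl⟩).symm
    rw [φ.one_of_mem_closedBall, Complex.ofReal_one]
    rw [Metric.mem_closedBall, Real.dist_eq, abs_le]
    change -ε ≤ _ ∧ _ ≤ ε
    constructor <;> linarith [hx.1, hx.2]

end Averages

/-! ### Flat functions when `NQ` holds, and the equivalences. -/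

section Nonquasianalytic

theorem sum_range_mul_div {r : ℕ} (hr : 1 ≤ r) (q : ℕ → ℝ) (N : ℕ) :
    ∑ i ∈ Finset.range (r * N), q (i / r) = r * ∑ p ∈ Finset.range N, q p := by
  induction N with
  | zero => simp
  | succ N ih =>
    rw [Nat.mul_succ, Finset.sum_range_add, ih, Finset.sum_range_succ, mul_add]
    congr 1
    rw [Finset.sum_congr rfl (g := fun _ => q N), Finset.sum_const, Finset.card_range,
      nsmul_eq_mul]
    intro i hi
    rw [Nat.mul_add_div (by omega), Nat.div_eq_of_lt (Finset.mem_range.1 hi), add_zero]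

/-- With tails `T p`, the choice `w p = 1 / √(T p)` works: `c p = T p - T (p + 1)` gives `c p * w p
≤ 2 (√(T p) - √(T (p + 1)))`, which telescopes. -/
theorem exists_tendsto_atTop_summable_mul {c : ℕ → ℝ} (hc : ∀ p, 0 < c p) (hs : Summable c) :
    ∃ w : ℕ → ℝ, (∀ p, 0 < w p) ∧ Filter.Tendsto w Filter.atTop Filter.atTop ∧
      Summable fun p => c p * w p := by
  set T : ℕ → ℝ := fun p => ∑' k, c (k + p) with hT
  have hsp : ∀ p, Summable fun k => c (k + p) := fun p => (summable_nat_add_iff p).2 hs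
  have hTpos : ∀ p, 0 < T p := fun p => (hsp p).tsum_pos (fun k => (hc _).le) 0 (hc _)
  have hstep : ∀ p, T p = c p + T (p + 1) := fun p => by
    simp only [hT]
    rw [(hsp p).tsum_eq_zero_add, zero_add]
    simp_rw [add_assoc, add_comm 1 p]
  have hsq : ∀ p, 0 < √(T p) := fun p => Real.sqrt_pos.2 (hTpos p)
  refine ⟨fun p => (√(T p))⁻¹, fun p => inv_pos.2 (hsq p), ?_, ?_⟩
  · refine Filter.Tendsto.inv_tendsto_nhdsGT_zero (tendsto_nhdsWithin_iff.2 ⟨?_, .of_forall hsq⟩)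
    simpa using (tendsto_sum_nat_add c).sqrt
  · refine summable_of_sum_range_le (c := 2 * √(T 0))
      (fun p => mul_nonneg (hc p).le (inv_pos.2 (hsq p)).le) fun n => ?_
    have hterm : ∀ p, c p * (√(T p))⁻¹ ≤ 2 * √(T p) - 2 * √(T (p + 1)) := fun p => by
      have h1 := Real.sq_sqrt (hTpos p).le
      have h2 := Real.sq_sqrt (hTpos (p + 1)).le
      rw [← div_eq_mul_inv, div_le_iff₀ (hsq p)]
      nlinarith [hstep p, sq_nonneg (√(T p) - √(T (p + 1)))]
    calc _ ≤ ∑ p ∈ Finset.range n, (2 * √(T p) - 2 * √(T (p + 1))) :=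
          Finset.sum_le_sum fun p _ => hterm p
      _ = 2 * √(T 0) - 2 * √(T n) := Finset.sum_range_sub' (fun p => 2 * √(T p)) n
      _ ≤ 2 * √(T 0) := by linarith [hsq n]

theorem exists_prod_range_le {x : ℕ → ℝ} (h0 : ∀ p, 0 ≤ x p)
    (h1 : ∀ᶠ p in Filter.atTop, x p ≤ 1) : ∃ C, ∀ n, ∏ p ∈ Finset.range n, x p ≤ C := by
  obtain ⟨P, hP⟩ := Filter.eventually_atTop.1 h1
  have hpos : ∀ n, 0 ≤ ∏ p ∈ Finset.range n, x p := fun n => Finset.prod_nonneg fun p _ => h0 p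
  have hsmall : ∀ n ≤ P, ∏ p ∈ Finset.range n, x p
      ≤ ∑ m ∈ Finset.range (P + 1), ∏ p ∈ Finset.range m, x p := fun n hn =>
    Finset.single_le_sum (f := fun m => ∏ p ∈ Finset.range m, x p) (fun m _ => hpos m)
      (Finset.mem_range.2 (Nat.lt_succ_of_le hn))
  refine ⟨∑ m ∈ Finset.range (P + 1), ∏ p ∈ Finset.range m, x p, fun n => ?_⟩
  rcases le_total n P with hn | hn
  · exact hsmall n hn
  · induction n, hn using Nat.le_induction with
    | base => exact hsmall P le_rfl
    | succ n hn ih =>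
      rw [Finset.prod_range_succ]
      exact (mul_le_of_le_one_right (hpos n) (hP n hn)).trans ih

variable {M : ℕ → ℝ} {r : ℕ} {a : ℝ}

theorem exists_bump_of_NQ (hM : IsLC M) (hr : 1 ≤ r) (hnq : NQ r M) (ha : 0 < a) :
    ∃ f : ℝ → ℂ, ContDiff ℝ ∞ f ∧ Function.support f ⊆ Set.Icc (a / 8) a ∧ f (a / 2) = 1 ∧
      ∀ h : ℝ, 0 < h → ∃ C : ℝ, ∀ n x, ‖iteratedDeriv (r * n) f x‖ / (h ^ n * M n) ≤ C := by
  have hr0 : (0 : ℝ) < r := by positivity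
  set c : ℕ → ℝ := fun p => (1 / mu M (p + 1)) ^ (1 / (r : ℝ)) with hcdef
  have hc : ∀ p, 0 < c p := fun p =>
    Real.rpow_pos_of_pos (one_div_pos.2 (hM.mu_pos p)) _
  have hcr : ∀ p, c p ^ r = (mu M (p + 1))⁻¹ := fun p => by
    rw [hcdef]
    simp only
    rw [one_div (r : ℝ), Real.rpow_inv_natCast_pow (one_div_pos.2 (hM.mu_pos p)).le (by omega),
      one_div]
  obtain ⟨w, hw, hwt, hws⟩ := exists_tendsto_atTop_summable_mul hc hnq
  have hσ : 0 < ∑' p, c p * w p := hws.tsum_pos (fun p => (mul_pos (hc p) (hw p)).le) 0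
    (mul_pos (hc 0) (hw 0))
  -- Normalized so that the steps `b (k / r)`, each `b p` taken `r` times, have total length `a /
  -- 8`.
  set δ : ℝ := a / 8 / (r * ∑' p, c p * w p) with hδdef
  have hδ : 0 < δ := by positivity
  set b : ℕ → ℝ := fun p => δ * (c p * w p) with hbdef
  have hb : ∀ p, 0 < b p := fun p => mul_pos hδ (mul_pos (hc p) (hw p))
  have hbs : Summable b := hws.mul_left δ
  have hbsum : r * ∑' p, b p = a / 8 := by
    rw [hbdef, tsum_mul_left, hδdef]
    field_simp
  have hpart : ∀ n, ∑ k ∈ Finset.range n, b (k / r) ≤ a / 8 := fun n =>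
    calc _ ≤ ∑ k ∈ Finset.range (r * n), b (k / r) :=
          Finset.sum_le_sum_of_subset_of_nonneg
            (Finset.range_mono (Nat.le_mul_of_pos_left n hr)) fun k _ _ => (hb _).le
      _ = r * ∑ p ∈ Finset.range n, b p := sum_range_mul_div hr b n
      _ ≤ r * ∑' p, b p := mul_le_mul_of_nonneg_left
          (hbs.sum_le_tsum _ fun p _ => (hb p).le) hr0.le
      _ = a / 8 := hbsum
  have hds : Summable fun k => b (k / r) := summable_of_sum_range_le (fun k => (hb _).le) hpart
  obtain ⟨f, hf, hsupp, hone, hbound⟩ := exists_smooth_bump_of_summable (d := fun k => b (k / r))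
    (l := a / 8) (ε := a / 8) (fun k => hb _) hds (by positivity)
    (Real.tsum_le_of_sum_range_le (fun k => (hb _).le) hpart)
  refine ⟨f, hf, hsupp.trans (Set.Icc_subset_Icc_right (by linarith)), ?_, fun h hh => ?_⟩
  · rw [← hone]
    congr 1
    ring
  -- These are the factors left from `(2 / b p) ^ r` after division by `h * μ_{p+1}`. They tend to
  -- `0` for every `h`, so their products stay bounded.
  have hθ : Filter.Tendsto (fun p => (2 / δ * (w p)⁻¹) ^ r / h) Filter.atTop (nhds 0) := by
    have := (((hwt.inv_tendsto_atTop).const_mul (2 / δ)).pow r).div_const h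
    simpa [zero_pow (show r ≠ 0 by omega)] using this
  obtain ⟨C, hC⟩ := exists_prod_range_le (x := fun p => (2 / δ * (w p)⁻¹) ^ r / h)
    (fun p => by have := hw p; positivity) (hθ.eventually_le_const one_pos)
  refine ⟨C, fun n x => ?_⟩
  have hMn := hM.pos n
  rw [div_le_iff₀ (by positivity)]
  calc ‖iteratedDeriv (r * n) f x‖ ≤ ∏ i ∈ Finset.range (r * n), (2 / b (i / r)) := hbound _ x
    _ = ∏ p ∈ Finset.range n, (2 / b p) ^ r := prod_range_mul_div hr (fun p => 2 / b p) n
    _ = ∏ p ∈ Finset.range n, ((2 / δ * (w p)⁻¹) ^ r / h * (h * mu M (p + 1))) := by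
        refine Finset.prod_congr rfl fun p _ => ?_
        have h1 : 2 / b p = 2 / δ * (w p)⁻¹ * (c p)⁻¹ := by
          have := hw p
          have := hc p
          simp only [hbdef]
          field_simp
        rw [h1, mul_pow, inv_pow (c p), hcr, inv_inv]
        field_simp
    _ = (∏ p ∈ Finset.range n, (2 / δ * (w p)⁻¹) ^ r / h) * (h ^ n * M n) := by
        rw [Finset.prod_mul_distrib, Finset.prod_mul_distrib, hM.prod_mu, Finset.prod_const,
          Finset.card_range]
    _ ≤ C * (h ^ n * M n) := by
        gcongr
        exact hC n

theorem not_borelInjective_of_mem {S : Set ℝ} (hu : UniqueDiffOn ℝ S) (h0 : (0 : ℝ) ∈ S)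
    {A : Set (ℝ → ℂ)} (hzero : (0 : ℝ → ℂ) ∈ A) {f : ℝ → ℂ} (hfA : f ∈ A)
    (hf : ContDiff ℝ ∞ f) (hflat : ∀ j, iteratedDeriv j f 0 = 0) {x : ℝ} (hx : x ∈ S)
    (hfx : f x ≠ 0) : ¬ BorelInjective S 0 A := by
  intro hinj
  refine hfx (hinj f hfA 0 hzero (funext fun j => ?_) hx)
  have hj : (j : ℕ∞ω) ≤ ∞ := by exact_mod_cast le_top
  rw [borelMap, borelMap,
    iteratedDerivWithin_eq_iteratedDeriv hu (hf.of_le hj).contDiffAt h0, hflat]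
  change 0 = iteratedDerivWithin j (fun _ : ℝ => (0 : ℂ)) S 0
  rw [iteratedDerivWithin_eq_iteratedDeriv hu contDiff_const.contDiffAt h0]
  simp

theorem Growth.of_iteratedDeriv {t : WeightType} {S : Set ℝ} (hu : UniqueDiffOn ℝ S) {f : ℝ → ℂ}
    (hf : ContDiff ℝ ∞ f)
    (hb : ∀ h : ℝ, 0 < h → ∃ C : ℝ, ∀ n x, ‖iteratedDeriv (r * n) f x‖ / (h ^ n * M n) ≤ C) :
    Growth t r M S f := by
  have key : ∀ h : ℝ, 0 < h → FiniteNorm r M S h f := fun h hh => by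
    obtain ⟨C, hC⟩ := hb h hh
    refine ⟨C, fun n x hx => ?_⟩
    have hn : ((r * n : ℕ) : ℕ∞ω) ≤ ∞ := by exact_mod_cast le_top
    rw [iteratedDerivWithin_eq_iteratedDeriv hu (hf.of_le hn).contDiffAt hx]
    exact hC n x
  cases t with
  | roumieu => exact ⟨1, one_pos, key 1 one_pos⟩
  | beurling => exact key

theorem RamifiedAtZero.of_iteratedDeriv {S : Set ℝ} (hu : UniqueDiffOn ℝ S) (h0 : (0 : ℝ) ∈ S)
    {f : ℝ → ℂ} (hf : ContDiff ℝ ∞ f) (hflat : ∀ j, 1 ≤ j → iteratedDeriv j f 0 = 0) :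
    RamifiedAtZero r S f := by
  intro n j hj _
  have hn : ((r * n + j : ℕ) : ℕ∞ω) ≤ ∞ := by exact_mod_cast le_top
  rw [iteratedDerivWithin_eq_iteratedDeriv hu (hf.of_le hn).contDiffAt h0, hflat _ (by omega)]

/-- The equivalences for a class that contains the smooth flat functions with support in
`[a / 8, a]` and the required bounds. -/
theorem class_iff (hM : IsLC M) (hr : 1 ≤ r) (ha : 0 < a) {t : WeightType} {S : Set ℝ}
    (hS : Convex ℝ S) (hu : UniqueDiffOn ℝ S) (hsub : Set.Icc 0 a ⊆ S) {A : Set (ℝ → ℂ)}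
    (hA : ∀ f ∈ A, ContDiffOn ℝ ∞ f S ∧ Growth t r M S f)
    (hA' : ∀ f, ContDiff ℝ ∞ f → Function.support f ⊆ Set.Icc 0 a →
      RamifiedAtZero r S f → Growth t r M S f → f ∈ A) :
    (¬ Quasianalytic S A ↔ NQ r M) ∧ (¬ BorelInjective S 0 A ↔ NQ r M) := by
  have h0 : (0 : ℝ) ∈ S := hsub ⟨le_rfl, ha.le⟩
  have hqa : ¬ NQ r M → Quasianalytic S A := fun h => quasianalytic_of_not_NQ hM hr h hS hu hA
  have hnq : NQ r M → ¬ BorelInjective S 0 A := fun h => by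
    obtain ⟨f, hf, hsupp, hone, hb⟩ := exists_bump_of_NQ hM hr h ha
    have hev : f =ᶠ[nhds 0] fun _ => 0 := by
      filter_upwards [Iio_mem_nhds (show (0 : ℝ) < a / 8 by positivity)] with x hx
      by_contra hne
      exact absurd (hsupp hne).1 (not_le.2 hx)
    have hflat : ∀ j, iteratedDeriv j f 0 = 0 := fun j => by
      rw [hev.iteratedDeriv_eq j]
      simp
    refine not_borelInjective_of_mem hu h0 (hA' 0 contDiff_const (by simp) ?_ ?_)
      (hA' f hf (hsupp.trans (Set.Icc_subset_Icc_left (by positivity))) ?_ ?_) hf hflat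
      (x := a / 2) (hsub ⟨by positivity, by linarith⟩) (by simp [hone])
    · exact .of_iteratedDeriv hu h0 contDiff_const fun j hj => by
        change iteratedDeriv j (fun _ : ℝ => (0 : ℂ)) 0 = 0
        simp
    · exact .of_iteratedDeriv hu contDiff_const fun h _ => ⟨0, fun n x => by
        change ‖iteratedDeriv (r * n) (fun _ : ℝ => (0 : ℂ)) x‖ / _ ≤ _
        simp⟩
    · exact .of_iteratedDeriv hu h0 hf fun j _ => hflat j
    · exact .of_iteratedDeriv hu hf hb
  refine ⟨⟨fun h => by_contra fun h' => h (hqa h'), fun h hq => hnq h (hq 0 h0)⟩,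
    ⟨fun h => by_contra fun h' => h (hqa h' 0 h0), hnq⟩⟩

end Nonquasianalytic

end RamifiedUltra

/-! ### The four classes as instances of `class_iff`. -/

theorem mainTheorem6 (M : ℕ → ℝ) (hM : RamifiedUltra.IsLC M) (r : ℕ) (hr : 1 ≤ r)
    (t : RamifiedUltra.WeightType) (a : ℝ) (ha : 0 < a) :
    -- nonquasianalyticity of each class
    (¬ RamifiedUltra.Quasianalytic Set.univ (RamifiedUltra.classD t r M a) ↔
      RamifiedUltra.NQ r M) ∧
    (¬ RamifiedUltra.Quasianalytic (Set.Ici 0) (RamifiedUltra.classL t r M a) ↔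
      RamifiedUltra.NQ r M) ∧
    (¬ RamifiedUltra.Quasianalytic (Set.Ici 0) (RamifiedUltra.classN t r M) ↔
      RamifiedUltra.NQ r M) ∧
    (¬ RamifiedUltra.Quasianalytic (Set.Icc 0 a) (RamifiedUltra.classE t r M a) ↔
      RamifiedUltra.NQ r M) ∧
    -- non-injectivity of the Borel map at the origin on each class
    (¬ RamifiedUltra.BorelInjective Set.univ 0 (RamifiedUltra.classD t r M a) ↔
      RamifiedUltra.NQ r M) ∧
    (¬ RamifiedUltra.BorelInjective (Set.Ici 0) 0 (RamifiedUltra.classL t r M a) ↔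
      RamifiedUltra.NQ r M) ∧
    (¬ RamifiedUltra.BorelInjective (Set.Ici 0) 0 (RamifiedUltra.classN t r M) ↔
      RamifiedUltra.NQ r M) ∧
    (¬ RamifiedUltra.BorelInjective (Set.Icc 0 a) 0 (RamifiedUltra.classE t r M a) ↔
      RamifiedUltra.NQ r M) := by
  have hD := RamifiedUltra.class_iff hM hr ha (t := t) (S := Set.univ) convex_univ
    uniqueDiffOn_univ (Set.subset_univ _) (A := RamifiedUltra.classD t r M a)
    (fun f hf => ⟨hf.1.contDiffOn, hf.2.2.2⟩)
    (fun f hf hs h1 h2 => ⟨hf, (closure_minimal hs isClosed_Icc).trans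
      (Set.Icc_subset_Icc_left (by linarith)), h1, h2⟩)
  have hL := RamifiedUltra.class_iff hM hr ha (t := t) (convex_Ici 0) (uniqueDiffOn_Ici 0)
    Set.Icc_subset_Ici_self (A := RamifiedUltra.classL t r M a)
    (fun f hf => ⟨hf.1, hf.2.2.2⟩)
    (fun f hf hs h1 h2 => ⟨hf.contDiffOn,
      closure_minimal (Set.inter_subset_left.trans hs) isClosed_Icc, h1, h2⟩)
  have hN := RamifiedUltra.class_iff hM hr ha (t := t) (convex_Ici 0) (uniqueDiffOn_Ici 0)
    Set.Icc_subset_Ici_self (A := RamifiedUltra.classN t r M)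
    (fun f hf => ⟨hf.1, hf.2.2⟩) (fun f hf _ h1 h2 => ⟨hf.contDiffOn, h1, h2⟩)
  have hE := RamifiedUltra.class_iff hM hr ha (t := t) (convex_Icc 0 a) (uniqueDiffOn_Icc ha)
    subset_rfl (A := RamifiedUltra.classE t r M a)
    (fun f hf => ⟨hf.1, hf.2.2⟩) (fun f hf _ h1 h2 => ⟨hf.contDiffOn, h1, h2⟩)
  exact ⟨hD.1, hL.1, hN.1, hE.1, hD.2, hL.2, hN.2, hE.2⟩
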